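/- Let $M$ be a natural number, $k>0$, and let $H=\mathrm{diag}(h_0,\dots,h_M)$ be a real diagonal matrix with $h_i\le 0$ for all $i$, $h_0=0$ and $h_M\neq 0$ (so that $M\ge 1$). Index the rows and columns of $(M+1)\times(M+1)$ matrices by $0,\dots,M$. Let $A$ be the symmetric tridiagonal matrix with zero diagonal and $A_{i,i+1}=A_{i+1,i}=\sqrt{i+1}$, let $B$ be the matrix whose only nonzero entries are $B_{i+1,i}=\sqrt{i+1}$, and let $G$ be the matrix whose only nonzero entry is $G_{1,0}=1$. For $m\in\mathbb Z\setminus\{0\}$ put $$G_m=-\mathrm i\,mk\Big(A+\frac1{(mk)^2}G\Big)+H .$$ Write $\|\cdot\|$ for the Euclidean norm on $\mathbb C^{M+1}$ and for the spectral norm of matrices. Consider the coefficients $\hat f^{(m)}=(\hat f^{(m)}_0,\dots,\hat f^{(m)}_M)^T:[0,\infty)\to\mathbb C^{M+1}$, $m\ge 1$, that solve the first-order equation $$\frac{d\hat f^{(1)}}{dt}+\mathrm i k\Big(A+\frac1{k^2}G\Big)\hat f^{(1)}=H\hat f^{(1)},\qquad \hat f^{(1)}(0)=(1,0,\dots,0)^T,$$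 and, for $m\ge 2$, the higher-order equations $$\frac{d\hat f^{(m)}}{dt}+\mathrm i mk\Big(A+\frac1{(mk)^2}G\Big)\hat f^{(m)}+\frac{\mathrm i}{k}\sum_{l=1}^{m-1}\frac1l\,\hat f^{(l)}_0\,B\,\hat f^{(m-l)}=H\hat f^{(m)},\qquad \hat f^{(m)}(0)=0$$ (the $\varepsilon$-expansion equations of filtered linear Landau damping). **Theorem.** There is a constant $\lambda^{(1)}>0$ such that for every $m\in\mathbb Z\setminus\{0\}$ all eigenvalues of $G_m$ have real part less than $-\lambda^{(1)}$. For every $\lambda^{(1)}>0$ with this property there is a constant $C^{(4)}>0$ such that $$\|\exp(tG_m)\|\le C^{(4)}(t^M+1)e^{-\lambda^{(1)}t}\qquad\text{for all } m\in\mathbb Z\setminus\{0\},\ t\ge 0,$$ and such that the constants $K^{(m)}$, $m\ge 1$, defined by $$K^{(1)}=C^{(4)},\qquad K^{(m)}=C^{(5)}\sum_{l=1}^{m-1}\frac1l\,K^{(l)}K^{(m-l)}\quad(m\ge 2),$$ $$C^{(5)}=\frac{\sqrt M}{k}\,C^{(4)}\int_0^\infty (s^M+1)^2e^{-\lambda^{(1)}s}\,ds,$$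 satisfy $$\big\|\hat f^{(m)}(t)\big\|\le K^{(m)}(t^M+1)e^{-\lambda^{(1)}t}\qquad\text{for all } m\ge 1,\ t\ge 0 .$$ -/

import Mathlib

noncomputable section

namespace FilteredLandau

/-- The symmetric tridiagonal matrix `A` of the Hermite moment system of order `M`
(indices `0, …, M`): the entries `(i, i+1)` and `(i+1, i)` are `√(i+1)`, all others vanish. -/
def matA (M : ℕ) : Matrix (Fin (M + 1)) (Fin (M + 1)) ℂ :=
  Matrix.of fun i j =>
    if (j : ℕ) = i + 1 then ((Real.sqrt (j : ℕ) : ℝ) : ℂ)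
    else if (i : ℕ) = j + 1 then ((Real.sqrt (i : ℕ) : ℝ) : ℂ)
    else 0

/-- The strictly lower triangular matrix `B`: the entry `(i+1, i)` is `√(i+1)`,
all others vanish. -/
def matB (M : ℕ) : Matrix (Fin (M + 1)) (Fin (M + 1)) ℂ :=
  Matrix.of fun i j => if (i : ℕ) = j + 1 then ((Real.sqrt (i : ℕ) : ℝ) : ℂ) else 0

/-- The matrix `G` whose only nonzero entry is a `1` in the second row and first column. -/
def matG (M : ℕ) : Matrix (Fin (M + 1)) (Fin (M + 1)) ℂ :=
  Matrix.of fun i j => if (i : ℕ) = 1 ∧ (j : ℕ) = 0 then 1 else 0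

/-- The filter matrix `H = diag(h₀, …, h_M)`. -/
def matH {M : ℕ} (h : Fin (M + 1) → ℝ) : Matrix (Fin (M + 1)) (Fin (M + 1)) ℂ :=
  Matrix.diagonal fun i => (h i : ℂ)

/-- The matrix `A + (mk)⁻² G`. -/
def matAG (M : ℕ) (k : ℝ) (m : ℤ) : Matrix (Fin (M + 1)) (Fin (M + 1)) ℂ :=
  matA M + (1 / ((m : ℂ) * (k : ℂ)) ^ 2) • matG M

/-- The matrix `G_m = -i m k (A + (mk)⁻² G) + H`. -/
def matGm {M : ℕ} (k : ℝ) (h : Fin (M + 1) → ℝ) (m : ℤ) :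
    Matrix (Fin (M + 1)) (Fin (M + 1)) ℂ :=
  -(Complex.I * (m : ℂ) * (k : ℂ)) • matAG M k m + matH h

/-- A matrix acting on `ℂ^{M+1}` with the Euclidean norm; the norm of this continuous linear
map is the spectral norm of the matrix. -/
abbrev act {M : ℕ} (X : Matrix (Fin (M + 1)) (Fin (M + 1)) ℂ) :
    EuclideanSpace ℂ (Fin (M + 1)) →L[ℂ] EuclideanSpace ℂ (Fin (M + 1)) :=
  Matrix.toEuclideanCLM (n := Fin (M + 1)) (𝕜 := ℂ) X

/-- Every eigenvalue of every `G_m`, `m ∈ ℤ ∖ {0}`, has real part less than `-lam`. -/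
def IsSpectralRate {M : ℕ} (k : ℝ) (h : Fin (M + 1) → ℝ) (lam : ℝ) : Prop :=
  ∀ m : ℤ, m ≠ 0 → ∀ μ : ℂ,
    Module.End.HasEigenvalue (Matrix.toLin' (matGm k h m)) μ → μ.re < -lam

/-- `f m : [0, ∞) → ℂ^{M+1}`, `m ≥ 1`, solve the first-order and the higher-order equations of
the `ε`-expansion, with their initial conditions. (The value `f 0` plays no role: the zeroth
order coefficient is the constant vector `(1, 0, …, 0)` and enters through `G`.) -/
structure IsExpansionSolution {M : ℕ} (k : ℝ) (h : Fin (M + 1) → ℝ)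
    (f : ℕ → ℝ → EuclideanSpace ℂ (Fin (M + 1))) : Prop where
  first_init : f 1 0 = EuclideanSpace.single 0 1
  first_eq : ∀ t : ℝ, 0 ≤ t →
    HasDerivWithinAt (f 1)
      (act (matH h) (f 1 t) - (Complex.I * (k : ℂ)) • act (matAG M k 1) (f 1 t))
      (Set.Ici 0) t
  higher_init : ∀ m : ℕ, 2 ≤ m → f m 0 = 0
  higher_eq : ∀ m : ℕ, 2 ≤ m → ∀ t : ℝ, 0 ≤ t →
    HasDerivWithinAt (f m)
      (act (matH h) (f m t)
        - (Complex.I * (m : ℂ) * (k : ℂ)) • act (matAG M k m) (f m t)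
        - (Complex.I / (k : ℂ)) • ∑ l ∈ Finset.Icc 1 (m - 1),
            ((1 / (l : ℂ)) * f l t 0) • act (matB M) (f (m - l) t))
      (Set.Ici 0) t

/-- The constant `C⁽⁵⁾ = (√M / k) C⁽⁴⁾ ∫₀^∞ (s^M + 1)² e^{-lam s} ds`. -/
def constC5 (M : ℕ) (k lam C4 : ℝ) : ℝ :=
  Real.sqrt M / k * C4 * ∫ s in Set.Ioi (0 : ℝ), (s ^ M + 1) ^ 2 * Real.exp (-lam * s)

end FilteredLandau

end

/-! Everything must be uniform in `m`, although `G_m` grows like `|m|`.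

Spectral gap. A diagonal weight changing only entry 0 makes `A + (mk)⁻² G` symmetric. Pairing the
eigenvalue equation with `v` in the weighted inner product, the term with `i m k` is purely
imaginary, so `Re μ · ∑ wᵢ|vᵢ|² = ∑ wᵢ hᵢ |vᵢ|² ≤ h_M |v_M|²`. The eigenvalue equation is a
three-term recurrence; run backwards and divided by `|mk|`, it bounds every entry of `v` by a
uniform multiple of `|v_M|`. Hence `Re μ` stays below a fixed negative number (`re_mul_sum_weight`,
`norm_eigenvector_le`).

Semigroup. `-i m k A` is skew-Hermitian, so `G_m + G_mᴴ` is bounded uniformly in `m`. In a unitary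
triangularisation the off-diagonal entries of `T` are also entries of `T + Tᴴ`, hence uniformly
bounded. Splitting off one left eigenvector at a time and applying Duhamel gives `(2 + νt)^M
e^{-λt}` (`norm_exp_le_of_restrict`, `norm_exp_le_of_eigenvalues`).

Expansion. Strong induction on `m` with Duhamel: the quadratic source decays like `e^{-2λs}`. One
factor turns `e^{-λ(t-s)}` into `e^{-λt}`, the other makes the integral in `C⁽⁵⁾` converge; the
convolution structure of the source is the recursion for `K⁽ᵐ⁾`. -/

noncomputable section

namespace FilteredLandau

open Set MeasureTheory
open scoped InnerProductSpace

/-! ### Variation of constants -/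

section Duhamel

variable {E : Type*} [NormedAddCommGroup E] [NormedSpace ℂ E] [CompleteSpace E]

/-- The operator group `t ↦ exp (t T)` has derivative `exp (t T) T`. -/
lemma hasDerivAt_exp_ofReal_smul (T : E →L[ℂ] E) (t : ℝ) :
    HasDerivAt (fun s : ℝ => NormedSpace.exp ((s : ℂ) • T))
      (NormedSpace.exp ((t : ℂ) • T) * T) t := by
  simpa [Function.comp_def] using (hasDerivAt_exp_smul_const T (t : ℂ)).scomp_of_eq t
    (Complex.ofRealCLM.hasDerivAt (x := t)) rfl

lemma hasDerivAt_exp_ofReal_smul_apply (T : E →L[ℂ] E) (x : E) (t : ℝ) :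
    HasDerivAt (fun s : ℝ => NormedSpace.exp ((s : ℂ) • T) x)
      (T (NormedSpace.exp ((t : ℂ) • T) x)) t := by
  have h1 : HasDerivAt (fun s : ℝ => NormedSpace.exp ((s : ℂ) • T))
      (T * NormedSpace.exp ((t : ℂ) • T)) t := by
    simpa [Function.comp_def] using (hasDerivAt_exp_smul_const' T (t : ℂ)).scomp_of_eq t
      (Complex.ofRealCLM.hasDerivAt (x := t)) rfl
  exact ((ContinuousLinearMap.apply ℂ E x).restrictScalars ℝ).hasFDerivAt.comp_hasDerivAt t h1

/-- Duhamel estimate for `f' = T f + g` on `[0, ∞)`. -/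
lemma norm_le_of_duhamel (T : E →L[ℂ] E) {f g : ℝ → E} {t : ℝ} (ht : 0 ≤ t)
    (hf : ∀ s, 0 ≤ s → HasDerivWithinAt f (T (f s) + g s) (Ici 0) s)
    {β : ℝ → ℝ} (hβ : Continuous β)
    (hg : ∀ s, 0 ≤ s → s ≤ t → ‖NormedSpace.exp (((t - s : ℝ) : ℂ) • T) (g s)‖ ≤ β s) :
    ‖f t‖ ≤ ‖NormedSpace.exp ((t : ℂ) • T) (f 0)‖ + ∫ s in (0 : ℝ)..t, β s := by
  -- In the derivative of `exp ((t - s) T) (f s)` the two terms containing `T (f s)` cancel.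
  have hv : ∀ s, 0 ≤ s → HasDerivWithinAt
      (fun s => NormedSpace.exp (((t - s : ℝ) : ℂ) • T) (f s))
      (NormedSpace.exp (((t - s : ℝ) : ℂ) • T) (g s)) (Ici 0) s := by
    intro s hs
    have h1 : HasDerivAt (fun s : ℝ => NormedSpace.exp (((t - s : ℝ) : ℂ) • T))
        (-(NormedSpace.exp (((t - s : ℝ) : ℂ) • T) * T)) s := by
      have := (hasDerivAt_exp_ofReal_smul T (t - s)).scomp s ((hasDerivAt_id s).const_sub t)
      rwa [neg_one_smul] at this
    have h2 : HasDerivAt (fun s : ℝ => (NormedSpace.exp (((t - s : ℝ) : ℂ) • T)).restrictScalars ℝ)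
        ((-(NormedSpace.exp (((t - s : ℝ) : ℂ) • T) * T)).restrictScalars ℝ) s :=
      (ContinuousLinearMap.restrictScalarsL ℂ E E ℝ ℝ).hasFDerivAt.comp_hasDerivAt s h1
    have h3 := h2.hasDerivWithinAt.clm_apply (hf s hs)
    have h4 : NormedSpace.exp (((t - s : ℝ) : ℂ) • T) (g s) =
        -(NormedSpace.exp (((t - s : ℝ) : ℂ) • T) (T (f s))) +
          NormedSpace.exp (((t - s : ℝ) : ℂ) • T) (T (f s) + g s) := by
      rw [map_add, neg_add_cancel_left]
    rw [h4]
    exact h3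
  have hB : ∀ s, HasDerivAt (fun s => ‖NormedSpace.exp ((t : ℂ) • T) (f 0)‖ +
      ∫ r in (0 : ℝ)..s, β r) (β s) s := fun s =>
    (hβ.integral_hasStrictDerivAt 0 s).hasDerivAt.const_add _
  -- The mean value inequality replaces integration of the source, so `g` needs no regularity, only
  -- the continuous majorant `β`.
  have := image_norm_le_of_norm_deriv_right_le_deriv_boundary (a := 0) (b := t)
    (fun s hs => ((hv s hs.1).continuousWithinAt).mono Icc_subset_Ici_self)
    (fun s hs => (hv s hs.1).mono (Ici_subset_Ici.2 hs.1)) (by simp) hB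
    (fun s hs => hg s hs.1 hs.2.le) (right_mem_Icc.2 ht)
  simpa using this

end Duhamel

/-! ### Unitary triangularisation and growth of the exponential -/

section Triangular

variable {E : Type*} [NormedAddCommGroup E] [InnerProductSpace ℂ E] [FiniteDimensional ℂ E]

/-- A nontrivial finite-dimensional operator has a unit left eigenvector, whose eigenvalue is also
an eigenvalue of the operator. -/
lemma exists_left_eigenvector [Nontrivial E] (T : E →L[ℂ] E) :
    ∃ (d : ℂ) (u : E), ‖u‖ = 1 ∧ (∀ x : E, ⟪u, T x⟫_ℂ = d * ⟪u, x⟫_ℂ) ∧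
      ∃ v : E, v ≠ 0 ∧ T v = d • v := by
  have : CompleteSpace E := FiniteDimensional.complete ℂ E
  obtain ⟨e, he⟩ := Module.End.exists_eigenvalue
    ((ContinuousLinearMap.adjoint T : E →L[ℂ] E) : E →ₗ[ℂ] E)
  obtain ⟨u, hu⟩ := he.exists_hasEigenvector
  have hu0 : u ≠ 0 := hu.2
  have hSu : ContinuousLinearMap.adjoint T u = e • u := hu.apply_eq_smul
  have key : ∀ x, ⟪u, T x⟫_ℂ = star e * ⟪u, x⟫_ℂ := by
    intro x
    rw [← ContinuousLinearMap.adjoint_inner_left, hSu, inner_smul_left]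
    rfl
  refine ⟨star e, ((‖u‖⁻¹ : ℝ) : ℂ) • u, ?_, ?_, ?_⟩
  · have : ‖u‖ ≠ 0 := norm_ne_zero_iff.2 hu0
    simp [norm_smul, this]
  · intro x
    rw [inner_smul_left, inner_smul_left, key]
    ring
  -- Otherwise `T - d` is injective, hence surjective; but its range is orthogonal to `u ≠ 0`.
  · by_contra! hcon
    have hinj : Function.Injective ((T : E →ₗ[ℂ] E) - star e • (LinearMap.id : E →ₗ[ℂ] E)) := by
      rw [← LinearMap.ker_eq_bot, LinearMap.ker_eq_bot']
      intro v hv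
      by_contra hv0
      exact hcon v hv0 (sub_eq_zero.1 (by simpa using hv))
    obtain ⟨x, hx⟩ := LinearMap.injective_iff_surjective.1 hinj u
    have h1 : ⟪u, u⟫_ℂ = 0 := by
      nth_rw 2 [← hx]
      change ⟪u, T x - star e • x⟫_ℂ = 0
      rw [inner_sub_right, inner_smul_right, key, sub_self]
    exact hu0 (inner_self_eq_zero.1 h1)

/-- If `T` leaves the orthogonal complement of a unit vector `u` invariant (realised as the range
of an isometry `ι`), a bound for the exponential of the restriction gives one for `exp (t T)`. -/
lemma norm_exp_le_of_restrict {F : Type*} [NormedAddCommGroup F] [InnerProductSpace ℂ F]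
    [FiniteDimensional ℂ F] (T : E →L[ℂ] E) (S : F →L[ℂ] F) (ι : F →L[ℂ] E) (π : E →L[ℂ] F)
    {lam ν P t : ℝ} (hν : 0 ≤ ν) (hP : 0 ≤ P)
    (ht : 0 ≤ t) (hT : ∀ x y : E, ‖⟪x, T y⟫_ℂ + ⟪T x, y⟫_ℂ‖ ≤ ν * ‖x‖ * ‖y‖)
    {d : ℂ} (hd : d.re ≤ -lam)
    {u : E} (hu : ‖u‖ = 1) (hTu : ∀ x : E, ⟪u, T x⟫_ℂ = d * ⟪u, x⟫_ℂ)
    (hι : ∀ x, ‖ι x‖ = ‖x‖) (hιu : ∀ x, ⟪ι x, u⟫_ℂ = 0) (hTι : ∀ x, T (ι x) = ι (S x))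
    (hπι : ∀ x, π (ι x) = x) (hπ : ∀ x, ‖π x‖ ≤ ‖x‖)
    (hdecomp : ∀ x, x = ⟪u, x⟫_ℂ • u + ι (π x))
    (hexp : ∀ s, 0 ≤ s → s ≤ t →
      ‖NormedSpace.exp ((s : ℂ) • S)‖ ≤ P * Real.exp (-lam * s)) :
    ‖NormedSpace.exp ((t : ℂ) • T)‖ ≤ (1 + P * (1 + ν * t)) * Real.exp (-lam * t) := by
  have : CompleteSpace E := FiniteDimensional.complete ℂ E
  have : CompleteSpace F := FiniteDimensional.complete ℂ F
  refine ContinuousLinearMap.opNorm_le_bound _ (by positivity) fun y₀ => ?_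
  set y : ℝ → E := fun s => NormedSpace.exp ((s : ℂ) • T) y₀ with hy
  -- With `y = c u + ι w`, the flow is triangular: `c' = d c` and `w' = S w + c π(Tu)`.
  set c : ℝ → ℂ := fun s => ⟪u, y s⟫_ℂ with hc
  have hy' : ∀ s, HasDerivAt y (T (y s)) s := hasDerivAt_exp_ofReal_smul_apply T y₀
  have hy0 : y 0 = y₀ := by simp [hy]
  have hc' : ∀ s, HasDerivAt c (d * c s) s := by
    intro s
    have := ((innerSL ℂ u).restrictScalars ℝ).hasFDerivAt.comp_hasDerivAt s (hy' s)
    simpa [hTu, Function.comp_def] using this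
  have hc0 : ‖c 0‖ ≤ ‖y₀‖ := by
    have := norm_inner_le_norm (𝕜 := ℂ) u (y 0)
    rw [hu, one_mul] at this
    exact this.trans_eq (by rw [hy0])
  have hcs : ∀ s : ℝ, c s = Complex.exp (d * s) * c 0 := by
    intro s
    have hdc : ∀ r : ℝ, HasDerivAt (fun r : ℝ => Complex.exp (-(d * r)) * c r) 0 r := by
      intro r
      have h1 : HasDerivAt (fun r : ℝ => -(d * (r : ℂ))) (-d) r := by
        simpa using ((Complex.ofRealCLM.hasDerivAt (x := r)).const_mul d).fun_neg
      have h2 := h1.cexp.mul (hc' r)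
      have h3 : Complex.exp (-(d * r)) * -d * c r + Complex.exp (-(d * r)) * (d * c r) = 0 := by
        ring
      rwa [h3] at h2
    have := is_const_of_deriv_eq_zero (fun r => (hdc r).differentiableAt)
      (fun r => (hdc r).deriv) s 0
    simp only [Complex.ofReal_zero, mul_zero, neg_zero, Complex.exp_zero, one_mul] at this
    rw [← this, ← mul_assoc, ← Complex.exp_add]
    simp
  have hcle : ∀ s, 0 ≤ s → ‖c s‖ ≤ Real.exp (-lam * s) * ‖y₀‖ := by
    intro s hs
    rw [hcs, norm_mul, Complex.norm_exp]
    gcongr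
    simpa using mul_le_mul_of_nonneg_right hd hs
  -- The coupling is seen by the Hermitian part alone: for `x = ι (π (T u))`, `T x` stays orthogonal
  -- to `u`, so the form reduces to `⟪x, T u⟫ = ‖π (T u)‖²`.
  have hπu : ‖π (T u)‖ ≤ ν := by
    have h1 := hT (ι (π (T u))) u
    have h3 : ⟪ι (π (T u)), T u⟫_ℂ = ((‖π (T u)‖ : ℝ) : ℂ) ^ 2 := by
      have h4 : ⟪ι (π (T u)), ⟪u, T u⟫_ℂ • u + ι (π (T u))⟫_ℂ = ((‖π (T u)‖ : ℝ) : ℂ) ^ 2 := by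
        rw [inner_add_right, inner_smul_right, hιu, mul_zero, zero_add,
          inner_self_eq_norm_sq_to_K, hι]
        rfl
      rwa [← hdecomp] at h4
    rw [hTι, hιu, h3, add_zero, hu, mul_one, hι, norm_pow, Complex.norm_real, norm_norm] at h1
    by_contra! hlt
    have hpos : 0 < ‖π (T u)‖ := hν.trans_lt hlt
    rw [sq] at h1
    exact absurd (le_of_mul_le_mul_right h1 hpos) (not_le.2 hlt)
  have hw' : ∀ s, 0 ≤ s → HasDerivWithinAt (fun s => π (y s))
      (S (π (y s)) + c s • π (T u)) (Ici 0) s := by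
    intro s _
    have h1 := ((π.restrictScalars ℝ).hasFDerivAt.comp_hasDerivAt s (hy' s)).hasDerivWithinAt
      (s := Ici 0)
    have h2 : T (y s) = c s • T u + T (ι (π (y s))) := by
      conv_lhs => rw [hdecomp (y s)]
      rw [map_add, map_smul]
    have h3 : π (T (y s)) = S (π (y s)) + c s • π (T u) := by
      rw [h2, map_add, map_smul, hTι, hπι, add_comm]
    rw [← h3]
    exact h1
  -- The exponentials at `t - s` and `s` multiply to `e^{-λt}`, so the majorant is constant in `s`
  -- and integration costs one factor `t`.
  have hw := norm_le_of_duhamel S ht hw' (β := fun _ => P * Real.exp (-lam * t) *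
    (‖y₀‖ * ν)) continuous_const (by
      intro s hs hst
      refine (ContinuousLinearMap.le_opNorm _ _).trans ?_
      rw [norm_smul]
      calc _ ≤ (P * Real.exp (-lam * (t - s))) * ((Real.exp (-lam * s) * ‖y₀‖) * ν) := by
            gcongr
            · exact hexp _ (by linarith) (by linarith)
            · exact hcle s hs
        _ = P * (Real.exp (-lam * (t - s)) * Real.exp (-lam * s)) * (‖y₀‖ * ν) := by ring
        _ = _ := by rw [← Real.exp_add]; ring_nf)
  have hw0 : ‖NormedSpace.exp ((t : ℂ) • S) (π (y 0))‖ ≤ P * Real.exp (-lam * t) * ‖y₀‖ := by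
    refine (ContinuousLinearMap.le_opNorm _ _).trans ?_
    gcongr
    · exact hexp t ht le_rfl
    · rw [hy0]
      exact hπ y₀
  rw [intervalIntegral.integral_const] at hw
  have : ‖y t‖ ≤ ‖c t‖ + ‖π (y t)‖ := by
    conv_lhs => rw [hdecomp (y t)]
    refine (norm_add_le _ _).trans ?_
    rw [norm_smul, hu, mul_one, hι]
  change ‖y t‖ ≤ _
  simp only [sub_zero, smul_eq_mul] at hw
  calc ‖y t‖ ≤ _ := this
    _ ≤ Real.exp (-lam * t) * ‖y₀‖ + (P * Real.exp (-lam * t) * ‖y₀‖ +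
        t * (P * Real.exp (-lam * t) * (‖y₀‖ * ν))) :=
      add_le_add (hcle t ht) (hw.trans (by gcongr))
    _ = _ := by ring

/-- Splitting off a left eigenvector: the data needed for an induction on the dimension. -/
lemma exists_restrict {n : ℕ} (hE : Module.finrank ℂ E = n + 1) (T : E →L[ℂ] E) :
    ∃ (d : ℂ) (u : E) (S : EuclideanSpace ℂ (Fin n) →L[ℂ] EuclideanSpace ℂ (Fin n))
      (ι : EuclideanSpace ℂ (Fin n) →L[ℂ] E) (π : E →L[ℂ] EuclideanSpace ℂ (Fin n)),
      (∃ v : E, v ≠ 0 ∧ T v = d • v) ∧ ‖u‖ = 1 ∧ (∀ x : E, ⟪u, T x⟫_ℂ = d * ⟪u, x⟫_ℂ) ∧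
      (∀ x y, ⟪ι x, ι y⟫_ℂ = ⟪x, y⟫_ℂ) ∧ (∀ x, ⟪ι x, u⟫_ℂ = 0) ∧ (∀ x, T (ι x) = ι (S x)) ∧
      (∀ x, π (ι x) = x) ∧ (∀ x, ‖π x‖ ≤ ‖x‖) ∧ (∀ x, x = ⟪u, x⟫_ℂ • u + ι (π x)) := by
  have : Nontrivial E := Module.nontrivial_of_finrank_pos (R := ℂ) (by omega)
  obtain ⟨d, u, hu, hTu, hv⟩ := exists_left_eigenvector T
  have : Fact (Module.finrank ℂ E = n + 1) := ⟨hE⟩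
  have hu0 : u ≠ 0 := by rintro rfl; simp at hu
  have hfr : Module.finrank ℂ (ℂ ∙ u)ᗮ = n := Submodule.finrank_orthogonal_span_singleton hu0
  set W : Submodule ℂ E := (ℂ ∙ u)ᗮ with hW
  let e : W ≃ₗᵢ[ℂ] EuclideanSpace ℂ (Fin n) :=
    ((stdOrthonormalBasis ℂ W).reindex (finCongr hfr)).repr
  let ι : EuclideanSpace ℂ (Fin n) →L[ℂ] E :=
    W.subtypeL ∘L (e.symm.toContinuousLinearEquiv : _ →L[ℂ] _)
  let π : E →L[ℂ] EuclideanSpace ℂ (Fin n) :=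
    (e.toContinuousLinearEquiv : _ →L[ℂ] _) ∘L W.orthogonalProjectionOnto
  have hdecomp : ∀ x, x = ⟪u, x⟫_ℂ • u + ι (π x) := by
    intro x
    have h1 := Submodule.starProjection_add_starProjection_orthogonal (K := ℂ ∙ u) x
    rw [Submodule.starProjection_unit_singleton ℂ hu] at h1
    refine h1.symm.trans ?_
    congr 1
    simp only [ι, π, ContinuousLinearMap.comp_apply]
    change _ = ((e.symm (e (W.orthogonalProjectionOnto x)) : W) : E)
    rw [e.symm_apply_apply]
    rfl
  have hιu : ∀ x, ⟪ι x, u⟫_ℂ = 0 := fun x =>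
    Submodule.inner_left_of_mem_orthogonal (Submodule.mem_span_singleton_self u) (e.symm x).2
  have huι : ∀ x, ⟪u, ι x⟫_ℂ = 0 := fun x => inner_eq_zero_symm.1 (hιu x)
  refine ⟨d, u, π ∘L T ∘L ι, ι, π, hv, hu, hTu, fun x y => ?_, hιu, fun x => ?_, fun x => ?_,
    fun x => ?_, hdecomp⟩
  · exact e.symm.inner_map_map x y
  -- `uᗮ` is invariant because `u` is a left eigenvector: the `u`-component of `T (ι x)` is `d ⟪u, ι
  -- x⟫ = 0`.
  · have h1 := hdecomp (T (ι x))
    rwa [hTu, huι, mul_zero, zero_smul, zero_add] at h1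
  · change e (W.orthogonalProjectionOnto ((e.symm x : W) : E)) = x
    rw [Submodule.orthogonalProjectionOnto_mem_subspace_eq_self, e.apply_symm_apply]
  · change ‖e (W.orthogonalProjectionOnto x)‖ ≤ _
    rw [e.norm_map]
    exact (W.orthogonalProjectionOnto.le_opNorm x).trans (mul_le_of_le_one_left (norm_nonneg _)
        W.orthogonalProjectionOnto_norm_le)

end Triangular

/-- An operator whose Hermitian part is bounded by `ν` and whose eigenvalues have real part at most
`-lam` satisfies `‖exp (t T)‖ ≤ (2 + ν t) ^ (dim - 1) e ^ (-lam t)`. -/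
lemma norm_exp_le_of_eigenvalues (n : ℕ) :
    ∀ (T : EuclideanSpace ℂ (Fin (n + 1)) →L[ℂ] EuclideanSpace ℂ (Fin (n + 1))) {lam ν t : ℝ},
    0 ≤ ν → 0 ≤ t →
    (∀ x y, ‖⟪x, T y⟫_ℂ + ⟪T x, y⟫_ℂ‖ ≤ ν * ‖x‖ * ‖y‖) →
    (∀ (μ : ℂ) x, x ≠ 0 → T x = μ • x → μ.re ≤ -lam) →
    ‖NormedSpace.exp ((t : ℂ) • T)‖ ≤ (2 + ν * t) ^ n * Real.exp (-lam * t) := by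
  induction n with
  | zero =>
    intro T lam ν t hν ht hT hev
    obtain ⟨d, u, S, ι, π, ⟨v, hv, hTv⟩, hu, hTu, hι, hιu, hTι, hπι, hπ, hdecomp⟩ :=
      exists_restrict (n := 0) (by simp) T
    have hι' : ∀ x, ‖ι x‖ = ‖x‖ := fun x => by
      rw [@norm_eq_sqrt_re_inner ℂ, @norm_eq_sqrt_re_inner ℂ _ _ _ _ x, hι]
    -- The complement is the zero space, so its exponential has norm 0.
    have := norm_exp_le_of_restrict T S ι π (P := 0) hν le_rfl ht hT (hev d v hv hTv) hu hTu hι'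
      hιu hTι hπι hπ hdecomp (by
        intro s _ _
        rw [zero_mul]
        exact ContinuousLinearMap.opNorm_le_bound _ le_rfl fun x => by
          rw [Subsingleton.elim (NormedSpace.exp ((s : ℂ) • S) x) 0]; simp)
    rwa [zero_mul, add_zero, ← pow_zero (2 + ν * t)] at this
  | succ n ih =>
    intro T lam ν t hν ht hT hev
    obtain ⟨d, u, S, ι, π, ⟨v, hv, hTv⟩, hu, hTu, hι, hιu, hTι, hπι, hπ, hdecomp⟩ :=
      exists_restrict (n := n + 1) (by simp) T
    have hι' : ∀ x, ‖ι x‖ = ‖x‖ := fun x => by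
      rw [@norm_eq_sqrt_re_inner ℂ, @norm_eq_sqrt_re_inner ℂ _ _ _ _ x, hι]
    -- `S` inherits the Hermitian bound and the eigenvalue condition through the isometry `ι`; the
    -- polynomial is frozen at the endpoint `t`, which dominates all `s ≤ t`.
    have h1 := norm_exp_le_of_restrict T S ι π (P := (2 + ν * t) ^ n) hν (by positivity) ht hT
      (hev d v hv hTv) hu hTu hι' hιu hTι hπι hπ hdecomp (by
        intro s hs hst
        refine (ih S (lam := lam) hν hs (fun x y => ?_) (fun μ x hx hSx => ?_)).trans ?_
        · have := hT (ι x) (ι y)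
          rwa [hTι, hTι, hι, hι, hι', hι'] at this
        · refine hev μ (ι x) (fun h0 => hx ?_) (by rw [hTι, hSx, map_smul])
          rw [← norm_eq_zero, ← hι', h0, norm_zero]
        · gcongr)
    refine h1.trans ?_
    gcongr
    have h2 : (1 : ℝ) ≤ (2 + ν * t) ^ n := one_le_pow₀ (by nlinarith [mul_nonneg hν ht])
    rw [pow_succ]
    nlinarith

open Matrix

/-! ### Uniform semigroup bound for `G_m` -/

section SpectralBounds

variable {M : ℕ}

lemma matGm_eq {k : ℝ} (hk : k ≠ 0) (h : Fin (M + 1) → ℝ) {m : ℤ} (hm : m ≠ 0) :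
    matGm k h m = -(Complex.I * (m : ℂ) * (k : ℂ)) • matA M +
      (-(Complex.I / ((m : ℂ) * (k : ℂ)))) • matG M + matH h := by
  have hk' : (k : ℂ) ≠ 0 := by exact_mod_cast hk
  have hm' : (m : ℂ) ≠ 0 := by exact_mod_cast hm
  rw [matGm, matAG, smul_add, smul_smul]
  congr 3
  field_simp

lemma matA_conjTranspose : (matA M)ᴴ = matA M := by
  ext i j
  simp only [matA, conjTranspose_apply, of_apply]
  split_ifs with h1 h2 h2
  · omega
  · exact Complex.conj_ofReal _
  · exact Complex.conj_ofReal _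
  · simp

lemma matH_conjTranspose (h : Fin (M + 1) → ℝ) : (matH h)ᴴ = matH h := by
  rw [matH, diagonal_conjTranspose]
  congr 1
  ext i
  exact Complex.conj_ofReal _

/-- `A` is real symmetric, so the part of `G_m` that grows with `m` cancels; what is left of `G`
carries the factor `1/(mk)`. -/
lemma matGm_add_conjTranspose {k : ℝ} (hk : k ≠ 0) (h : Fin (M + 1) → ℝ) {m : ℤ} (hm : m ≠ 0) :
    matGm k h m + (matGm k h m)ᴴ =
      (2 : ℂ) • matH h + (-(Complex.I / ((m : ℂ) * (k : ℂ)))) • (matG M - (matG M)ᴴ) := by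
  rw [matGm_eq hk h hm]
  simp only [conjTranspose_add, conjTranspose_smul, matA_conjTranspose, matH_conjTranspose]
  have h1 : star (-(Complex.I * (m : ℂ) * (k : ℂ))) = Complex.I * (m : ℂ) * (k : ℂ) := by simp
  have h2 : star (-(Complex.I / ((m : ℂ) * (k : ℂ)))) = Complex.I / ((m : ℂ) * (k : ℂ)) := by
    simp [neg_div]
  rw [h1, h2]
  module

lemma le_norm_intCast_mul {k : ℝ} (hk : 0 < k) {m : ℤ} (hm : m ≠ 0) :
    k ≤ ‖(m : ℂ) * (k : ℂ)‖ := by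
  rw [norm_mul, Complex.norm_real, Complex.norm_intCast, Real.norm_of_nonneg hk.le]
  refine le_mul_of_one_le_left hk.le ?_
  exact_mod_cast Int.one_le_abs hm

/-- A bound, uniform in `m`, for the Hermitian part of `G_m`. -/
def hermBound (k : ℝ) (h : Fin (M + 1) → ℝ) : ℝ :=
  ‖act ((2 : ℂ) • matH h)‖ + 1 / k * ‖act (matG M - (matG M)ᴴ)‖

lemma norm_inner_add_inner_matGm_le {k : ℝ} (hk : 0 < k) (h : Fin (M + 1) → ℝ) {m : ℤ}
    (hm : m ≠ 0) (x y : EuclideanSpace ℂ (Fin (M + 1))) :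
    ‖⟪x, act (matGm k h m) y⟫_ℂ + ⟪act (matGm k h m) x, y⟫_ℂ‖ ≤ hermBound k h * ‖x‖ * ‖y‖ := by
  have h1 : ⟪act (matGm k h m) x, y⟫_ℂ = ⟪x, act (matGm k h m)ᴴ y⟫_ℂ := by
    have : act (matGm k h m)ᴴ = ContinuousLinearMap.adjoint (act (matGm k h m)) :=
      map_star (toEuclideanCLM (n := Fin (M + 1)) (𝕜 := ℂ)) (matGm k h m)
    rw [this, ContinuousLinearMap.adjoint_inner_right]
  have h2 : ‖act (matGm k h m + (matGm k h m)ᴴ)‖ ≤ hermBound k h := by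
    rw [matGm_add_conjTranspose hk.ne' h hm, act, map_add]
    refine (norm_add_le _ _).trans (add_le_add le_rfl ?_)
    rw [map_smul, norm_smul, norm_neg, norm_div, Complex.norm_I]
    gcongr
    exact le_norm_intCast_mul hk hm
  rw [h1, ← inner_add_right, ← _root_.add_apply]
  have h3 : act (matGm k h m) + act (matGm k h m)ᴴ = act (matGm k h m + (matGm k h m)ᴴ) :=
    (map_add _ _ _).symm
  rw [h3]
  refine (norm_inner_le_norm _ _).trans ?_
  rw [mul_right_comm, mul_comm]
  gcongr
  exact ContinuousLinearMap.le_of_opNorm_le _ h2 y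

lemma hasEigenvalue_of_act_apply {X : Matrix (Fin (M + 1)) (Fin (M + 1)) ℂ} {μ : ℂ}
    {x : EuclideanSpace ℂ (Fin (M + 1))} (hx : x ≠ 0) (hX : act X x = μ • x) :
    Module.End.HasEigenvalue (toLin' X) μ := by
  refine Module.End.hasEigenvalue_of_hasEigenvector (x := WithLp.ofLp x) ⟨?_, ?_⟩
  · rw [Module.End.mem_eigenspace_iff, toLin'_apply]
    exact congrArg WithLp.ofLp hX
  · exact fun h0 => hx (WithLp.ofLp_injective 2 h0)

/-- For the spectral norm on matrices, `toEuclideanCLM` is an isometric algebra isomorphism, hence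
continuous and compatible with the exponential series. -/
lemma act_exp (X : Matrix (Fin (M + 1)) (Fin (M + 1)) ℂ) :
    act (NormedSpace.exp X) = NormedSpace.exp (act X) := by
  open scoped Matrix.Norms.L2Operator in
  let _ : NormedAlgebra ℚ (Matrix (Fin (M + 1)) (Fin (M + 1)) ℂ) :=
    NormedAlgebra.restrictScalars ℚ ℂ _
  exact NormedSpace.map_exp (toEuclideanCLM (n := Fin (M + 1)) (𝕜 := ℂ))
    (AddMonoidHomClass.isometry_of_norm (toEuclideanCLM (n := Fin (M + 1)) (𝕜 := ℂ))
      fun _ => rfl).continuous X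

/-- The semigroups `exp (t G_m)` decay uniformly in `m`. -/
lemma exists_norm_exp_matGm_le {k : ℝ} (hk : 0 < k) (h : Fin (M + 1) → ℝ) :
    ∃ C : ℝ, 0 < C ∧ ∀ lam : ℝ, IsSpectralRate k h lam → ∀ m : ℤ, m ≠ 0 → ∀ t : ℝ, 0 ≤ t →
      ‖NormedSpace.exp ((t : ℂ) • act (matGm k h m))‖
        ≤ C * (t ^ M + 1) * Real.exp (-lam * t) := by
  set a : ℝ := max 2 (hermBound k h) with ha
  have ha2 : 2 ≤ a := le_max_left _ _
  have hν : 0 ≤ hermBound k h := by unfold hermBound; positivity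
  -- From `2 + νt ≤ a(t + 1)` and the convexity bound `(t + 1)^M ≤ 2^(M-1) (t^M + 1)`.
  refine ⟨a ^ M * 2 ^ (M - 1), by positivity, fun lam hlam m hm t ht => ?_⟩
  refine (norm_exp_le_of_eigenvalues M (act (matGm k h m)) (lam := lam) hν ht
    (norm_inner_add_inner_matGm_le hk h hm)
    (fun μ x hx hX => (hlam m hm μ (hasEigenvalue_of_act_apply hx hX)).le)).trans ?_
  gcongr
  calc (2 + hermBound k h * t) ^ M ≤ (a * (t + 1)) ^ M := by
        gcongr
        have : hermBound k h * t ≤ a * t := by gcongr; exact le_max_right _ _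
        linarith
    _ ≤ a ^ M * (2 ^ (M - 1) * (t ^ M + 1 ^ M)) := by
        rw [mul_pow]
        gcongr
        exact add_pow_le ht zero_le_one M
    _ = _ := by rw [one_pow, mul_assoc]

end SpectralBounds

/-! ### Spectral gap uniform in `m` -/

section SpectralGap

variable {M : ℕ}

/-- Extension of a vector by zero to all natural indices. -/
def extendZero (v : Fin (M + 1) → ℂ) (n : ℕ) : ℂ :=
  if hn : n < M + 1 then v ⟨n, hn⟩ else 0

lemma extendZero_coe (v : Fin (M + 1) → ℂ) (i : Fin (M + 1)) : extendZero v i = v i := by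
  rw [extendZero, dif_pos i.2]

/-- Missing neighbours drop out: at `i = 0` the truncated `i - 1` is killed by `√0`, at `i = M` the
extension by zero applies. -/
lemma matA_mulVec (v : Fin (M + 1) → ℂ) (i : Fin (M + 1)) :
    (matA M *ᵥ v) i = (Real.sqrt (i : ℕ) : ℂ) * extendZero v (i - 1) +
      (Real.sqrt ((i : ℕ) + 1 : ℕ) : ℂ) * extendZero v (i + 1) := by
  have h1 : ∀ j : Fin (M + 1), matA M i j * v j =
      (fun n : ℕ => (if n = (i : ℕ) + 1 then (Real.sqrt (n : ℕ) : ℂ) * extendZero v n else 0) +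
        (if (i : ℕ) = n + 1 then (Real.sqrt (i : ℕ) : ℂ) * extendZero v n else 0)) j := by
    intro j
    simp only [matA, of_apply, extendZero_coe]
    split_ifs with h1 h2 h2
    · omega
    · rw [add_zero]
    · rw [zero_add]
    · rw [zero_mul, add_zero]
  rw [mulVec, dotProduct, Finset.sum_congr rfl fun j _ => h1 j, Fin.sum_univ_eq_sum_range
    (fun n : ℕ => (if n = (i : ℕ) + 1 then (Real.sqrt (n : ℕ) : ℂ) * extendZero v n else 0) +
        (if (i : ℕ) = n + 1 then (Real.sqrt (i : ℕ) : ℂ) * extendZero v n else 0)),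
    Finset.sum_add_distrib, add_comm]
  congr 1
  · rcases Nat.eq_zero_or_pos (i : ℕ) with h0 | h0
    · simp [h0]
    · rw [Finset.sum_eq_single ((i : ℕ) - 1)]
      · rw [if_pos (by omega)]
      · intro b _ hb
        rw [if_neg (by omega)]
      · intro hb
        exact absurd (Finset.mem_range.2 (by omega)) hb
  · rw [Finset.sum_ite_eq']
    split_ifs with h0
    · rfl
    · rw [extendZero, dif_neg (by simpa using h0), mul_zero]

lemma matG_mulVec (v : Fin (M + 1) → ℂ) (i : Fin (M + 1)) :
    (matG M *ᵥ v) i = if (i : ℕ) = 1 then v 0 else 0 := by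
  rw [mulVec, dotProduct, Finset.sum_eq_single 0]
  · simp [matG]
  · intro j _ hj
    have : (j : ℕ) ≠ 0 := fun h0 => hj (Fin.ext h0)
    rw [matG, of_apply, if_neg (fun h0 => this h0.2), zero_mul]
  · simp

lemma matGm_mulVec (k : ℝ) (h : Fin (M + 1) → ℝ) (m : ℤ) (v : Fin (M + 1) → ℂ) (i : Fin (M + 1)) :
    (matGm k h m *ᵥ v) i = -(Complex.I * m * k) *
      ((Real.sqrt (i : ℕ) : ℂ) * (1 + if (i : ℕ) = 1 then 1 / ((m : ℂ) * k) ^ 2 else 0) *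
        extendZero v (i - 1) + (Real.sqrt ((i : ℕ) + 1 : ℕ) : ℂ) * extendZero v (i + 1)) +
      h i * v i := by
  have h0 : v 0 = extendZero v 0 := (extendZero_coe v 0).symm
  simp only [matGm, matAG, add_mulVec, smul_mulVec, Pi.add_apply, Pi.smul_apply, matA_mulVec,
    matG_mulVec, matH, mulVec_diagonal, smul_eq_mul]
  split_ifs with h1
  · rw [h0, h1, Nat.cast_one, Real.sqrt_one, Complex.ofReal_one]
    ring
  · ring

/-- The entries of an eigenvector of `G_m` are controlled by its last entry. -/
lemma norm_extendZero_le {w : ℕ → ℂ} {R : ℝ} (hR : 1 ≤ R) (hlast : w (M + 1) = 0)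
    (hrec : ∀ n, n < M → ‖w n‖ ≤ R * max ‖w (n + 1)‖ ‖w (n + 2)‖) :
    ∀ j ≤ M, ‖w (M - j)‖ ≤ R ^ j * ‖w M‖ ∧ ‖w (M - j + 1)‖ ≤ R ^ j * ‖w M‖ := by
  -- Two consecutive entries are carried along because the recurrence has order two.
  intro j
  induction j with
  | zero => simp [hlast]
  | succ j ih =>
    intro hj
    obtain ⟨h1, h2⟩ := ih (by omega)
    have h3 : M - j = M - (j + 1) + 1 := by omega
    rw [h3] at h1 h2
    have h0 : 0 ≤ R ^ j * ‖w M‖ := by positivity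
    refine ⟨(hrec _ (by omega)).trans ?_, h1.trans ?_⟩
    · rw [pow_succ', mul_assoc]
      gcongr
      exact max_le h1 h2
    · rw [pow_succ', mul_assoc]
      exact le_mul_of_one_le_left h0 hR

/-- The weights that make `A + (mk)⁻² G` symmetric. -/
def weight (k : ℝ) (m : ℤ) (i : Fin (M + 1)) : ℝ :=
  if (i : ℕ) = 0 then 1 + 1 / ((m : ℝ) * k) ^ 2 else 1

/-- `G` spoils symmetry only at the pair `(0,1)`, `(1,0)`; after weighting, both entries equal `1 +
1/(mk)²`. -/
lemma isHermitian_weight_mul_matAG (k : ℝ) (m : ℤ) :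
    (diagonal (fun i => (weight k m i : ℂ)) * matAG M k m).IsHermitian := by
  ext i j
  simp only [conjTranspose_apply, diagonal_mul, matAG, Matrix.add_apply, Matrix.smul_apply, matA,
    matG, of_apply, weight, smul_eq_mul]
  by_cases h1 : (j : ℕ) = i + 1
  · have h2 : ¬ ((i : ℕ) = j + 1) := by omega
    by_cases h5 : (i : ℕ) = 0
    · have h6 : (j : ℕ) = 1 := by omega
      simp [h5, h6, -Fin.val_eq_zero_iff]
    · simp only [h1, h5, and_false, if_true, if_false,
        if_neg (show ¬ (i : ℕ) = i + 1 + 1 by omega), if_neg (show ¬ (i : ℕ) + 1 = 0 by omega)]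
      simp
  · by_cases h2 : (i : ℕ) = j + 1
    · by_cases h5 : (j : ℕ) = 0
      · have h6 : (i : ℕ) = 1 := by omega
        simp [h5, h6, -Fin.val_eq_zero_iff]
      · simp only [h2, h5, and_false, if_true, if_false,
          if_neg (show ¬ (j : ℕ) = j + 1 + 1 by omega), if_neg (show ¬ (j : ℕ) + 1 = 0 by omega)]
        simp
    · have h4 : ¬ ((j : ℕ) = 1 ∧ (i : ℕ) = 0) := by omega
      have h6 : ¬ ((i : ℕ) = 1 ∧ (j : ℕ) = 0) := by omega
      simp [h1, h2, h4, h6, -Fin.val_eq_zero_iff]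

/-- Energy identity: in the weighted inner product the transport term is `i` times a real number, so
only the filter contributes to the real part. -/
lemma re_mul_sum_weight (k : ℝ) (h : Fin (M + 1) → ℝ) (m : ℤ) {μ : ℂ} {v : Fin (M + 1) → ℂ}
    (hv : matGm k h m *ᵥ v = μ • v) :
    μ.re * ∑ i, weight k m i * ‖v i‖ ^ 2 = ∑ i, weight k m i * h i * ‖v i‖ ^ 2 := by
  set D : Matrix (Fin (M + 1)) (Fin (M + 1)) ℂ := diagonal (fun i => (weight k m i : ℂ)) with hD
  have key : ∀ c : Fin (M + 1) → ℂ, star v ⬝ᵥ (D *ᵥ fun i => c i * v i) =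
      ∑ i, c i * ((weight k m i * ‖v i‖ ^ 2 : ℝ) : ℂ) := by
    intro c
    rw [dotProduct]
    refine Finset.sum_congr rfl fun i _ => ?_
    rw [hD, mulVec_diagonal]
    push_cast
    rw [← Complex.conj_mul', Pi.star_apply, RCLike.star_def]
    ring
  have h1 : star v ⬝ᵥ (D *ᵥ (matGm k h m *ᵥ v)) =
      -(Complex.I * m * k) * (star v ⬝ᵥ ((D * matAG M k m) *ᵥ v)) +
        star v ⬝ᵥ (D *ᵥ fun i => (h i : ℂ) * v i) := by
    have h2 : (fun i => (h i : ℂ) * v i) = matH h *ᵥ v := by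
      ext i
      rw [matH, mulVec_diagonal]
    rw [h2, matGm, add_mulVec, smul_mulVec, mulVec_add, mulVec_smul, dotProduct_add,
      dotProduct_smul, ← mulVec_mulVec, smul_eq_mul]
  have h2 : (star v ⬝ᵥ ((D * matAG M k m) *ᵥ v)).im = 0 :=
    (isHermitian_weight_mul_matAG k m).im_star_dotProduct_mulVec_self v
  have h3 : μ • v = fun i => (fun _ => μ) i * v i := rfl
  rw [hv, h3, key, key, ← Finset.mul_sum] at h1
  have h4 := congrArg Complex.re h1
  rw [← Complex.ofReal_sum, Complex.re_mul_ofReal, Complex.add_re] at h4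
  rw [h4]
  have h5 : (-(Complex.I * m * k) * (star v ⬝ᵥ ((D * matAG M k m) *ᵥ v))).re = 0 := by
    simp [Complex.mul_re, Complex.mul_im, h2]
  rw [h5, zero_add, Complex.re_sum]
  refine Finset.sum_congr rfl fun i _ => ?_
  rw [Complex.re_mul_ofReal, Complex.ofReal_re]
  ring

/-- A bound for `‖G_m‖ / |m k|`, uniform in `m`. -/
def ratioBound (k : ℝ) (h : Fin (M + 1) → ℝ) : ℝ :=
  ‖act (matA M)‖ + 1 / k ^ 2 * ‖act (matG M)‖ + ‖act (matH h)‖ / k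

lemma norm_act_matGm_le {k : ℝ} (hk : 0 < k) (h : Fin (M + 1) → ℝ) {m : ℤ} (hm : m ≠ 0) :
    ‖act (matGm k h m)‖ ≤ ‖(m : ℂ) * k‖ * ratioBound k h := by
  have hc := le_norm_intCast_mul hk hm
  have hc0 : 0 < ‖(m : ℂ) * k‖ := hk.trans_le hc
  rw [matGm, matAG, act, map_add, map_smul, map_add, map_smul]
  refine (norm_add_le _ _).trans ?_
  rw [norm_smul, norm_neg, mul_assoc Complex.I, norm_mul, Complex.norm_I, one_mul, ratioBound,
    mul_add (‖(m : ℂ) * k‖)]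
  gcongr ?_ * ?_ + ?_
  · refine (norm_add_le _ _).trans ?_
    rw [norm_smul, norm_div, norm_pow, norm_one]
    gcongr
  · rw [mul_div_assoc', le_div_iff₀ hk, mul_comm]
    gcongr

/-- Row `n + 1` of the eigenvalue equation is solved for `v_n`. Its coefficient has modulus at least
`|mk|`, while the others are `O(|mk|)` because `|μ| ≤ ‖G_m‖` and `|mk| ≥ k`; so the ratio is uniform
in `m`. The summand `M + 1` bounds `√(n+2)` and ensures that the ratio constant is at least 1. -/
lemma norm_eigenvector_le {k : ℝ} (hk : 0 < k) (h : Fin (M + 1) → ℝ) {m : ℤ} (hm : m ≠ 0) {μ : ℂ}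
    {v : Fin (M + 1) → ℂ} (hv0 : v ≠ 0) (hv : matGm k h m *ᵥ v = μ • v) (i : Fin (M + 1)) :
    ‖v i‖ ≤ (ratioBound k h + (∑ i, |h i|) / k + (M + 1)) ^ M * ‖v (Fin.last M)‖ := by
  set R : ℝ := ratioBound k h + (∑ i, |h i|) / k + (M + 1) with hRdef
  have hrb : 0 ≤ ratioBound k h := by unfold ratioBound; positivity
  have hsum : 0 ≤ (∑ i, |h i|) / k := by positivity
  have hR : 1 ≤ R := by
    have : (0 : ℝ) ≤ M := Nat.cast_nonneg M
    linarith
  have hc := le_norm_intCast_mul hk hm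
  have hc0 : 0 < ‖(m : ℂ) * k‖ := hk.trans_le hc
  have hμ : ‖μ‖ ≤ ‖(m : ℂ) * k‖ * ratioBound k h := by
    have h1 : act (matGm k h m) (WithLp.toLp 2 v) = μ • WithLp.toLp 2 v :=
      congrArg (WithLp.toLp 2) hv
    have h2 := ContinuousLinearMap.le_of_opNorm_le _ (norm_act_matGm_le hk h hm) (WithLp.toLp 2 v)
    rw [h1, norm_smul] at h2
    refine le_of_mul_le_mul_right h2 (norm_pos_iff.2 fun h0 => hv0 ?_)
    exact congrArg WithLp.ofLp h0
  have hrec : ∀ n, n < M → ‖extendZero v n‖ ≤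
      R * max ‖extendZero v (n + 1)‖ ‖extendZero v (n + 2)‖ := by
    intro n hn
    have h1 := congrFun hv ⟨n + 1, by omega⟩
    rw [matGm_mulVec] at h1
    simp only [Pi.smul_apply, smul_eq_mul, ← extendZero_coe v, add_tsub_cancel_right] at h1
    set b : ℂ := (Real.sqrt ((n + 1 : ℕ) : ℝ) : ℂ) *
      (1 + if n + 1 = 1 then 1 / ((m : ℂ) * k) ^ 2 else 0) with hb
    have hb1 : 1 ≤ ‖b‖ := by
      have h2 : b = ((Real.sqrt ((n + 1 : ℕ) : ℝ) *
          (1 + if n + 1 = 1 then 1 / ((m : ℝ) * k) ^ 2 else 0) : ℝ) : ℂ) := by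
        rw [hb]
        split_ifs <;> push_cast <;> rfl
      rw [h2, Complex.norm_real]
      refine le_trans ?_ (Real.le_norm_self _)
      have h3 : (1 : ℝ) ≤ Real.sqrt ((n + 1 : ℕ) : ℝ) := by
        rw [Real.one_le_sqrt]
        exact_mod_cast Nat.le_add_left 1 n
      have h4 : (0 : ℝ) ≤ if n + 1 = 1 then 1 / ((m : ℝ) * k) ^ 2 else 0 := by
        split_ifs <;> positivity
      nlinarith
    have hs : ‖(Real.sqrt ((n + 1 + 1 : ℕ) : ℝ) : ℂ)‖ ≤ M + 1 := by
      rw [Complex.norm_real, Real.norm_of_nonneg (Real.sqrt_nonneg _), Real.sqrt_le_left]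
      · have : ((n + 1 + 1 : ℕ) : ℝ) ≤ M + 1 := by exact_mod_cast (by omega)
        have h0 : (0 : ℝ) ≤ M := Nat.cast_nonneg M
        nlinarith
      · positivity
    have hh : |h ⟨n + 1, by omega⟩| ≤ ∑ i, |h i| :=
      Finset.single_le_sum (f := fun i => |h i|) (fun i _ => abs_nonneg _) (Finset.mem_univ _)
    set X := max ‖extendZero v (n + 1)‖ ‖extendZero v (n + 2)‖ with hX
    have h2 : Complex.I * ((m : ℂ) * k) * (b * extendZero v n) =
        ((h ⟨n + 1, by omega⟩ : ℂ) - μ) * extendZero v (n + 1) -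
          Complex.I * ((m : ℂ) * k) * ((Real.sqrt ((n + 1 + 1 : ℕ) : ℝ) : ℂ) *
            extendZero v (n + 2)) := by
      linear_combination -h1
    have h3 := congrArg norm h2
    rw [norm_mul, norm_mul Complex.I, Complex.norm_I, one_mul, norm_mul b] at h3
    have h4 : ‖(m : ℂ) * k‖ * ‖extendZero v n‖ ≤ ‖(m : ℂ) * k‖ * (R * X) := by
      calc ‖(m : ℂ) * k‖ * ‖extendZero v n‖
          ≤ ‖(m : ℂ) * k‖ * (‖b‖ * ‖extendZero v n‖) := by
            gcongr
            exact le_mul_of_one_le_left (norm_nonneg _) hb1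
        _ = _ := h3
        _ ≤ (∑ i, |h i| + ‖(m : ℂ) * k‖ * ratioBound k h) * X +
            ‖(m : ℂ) * k‖ * ((M + 1) * X) := by
          refine (norm_sub_le _ _).trans ?_
          rw [norm_mul, norm_mul (Complex.I * _), norm_mul Complex.I, Complex.norm_I, one_mul,
            norm_mul (Real.sqrt ((n + 1 + 1 : ℕ) : ℝ) : ℂ)]
          have h5 : ‖(h ⟨n + 1, by omega⟩ : ℂ) - μ‖ ≤
              ∑ i, |h i| + ‖(m : ℂ) * k‖ * ratioBound k h := by
            refine (norm_sub_le _ _).trans (add_le_add ?_ hμ)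
            rwa [Complex.norm_real]
          gcongr
          · exact le_max_left _ _
          · exact le_max_right _ _
        _ ≤ _ := by
          have hX0 : 0 ≤ X := (norm_nonneg _).trans (le_max_left _ _)
          have h6 : ∑ i, |h i| ≤ ‖(m : ℂ) * k‖ * ((∑ i, |h i|) / k) := by
            rw [mul_div_assoc', le_div_iff₀ hk, mul_comm]
            gcongr
          have h7 := mul_le_mul_of_nonneg_right h6 hX0
          rw [hRdef]
          nlinarith
    exact le_of_mul_le_mul_left h4 hc0
  have h1 := (norm_extendZero_le hR (by simp [extendZero]) hrec (M - i) (by omega)).1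
  rw [Nat.sub_sub_self (by omega), extendZero_coe] at h1
  have h2 : extendZero v M = v (Fin.last M) := extendZero_coe v (Fin.last M)
  rw [h2] at h1
  refine h1.trans ?_
  gcongr
  omega

/-- The matrices `G_m` have a common spectral gap. -/
lemma exists_isSpectralRate {k : ℝ} (hk : 0 < k) (h : Fin (M + 1) → ℝ) (h_nonpos : ∀ i, h i ≤ 0)
    (h_last : h (Fin.last M) ≠ 0) : ∃ lam : ℝ, 0 < lam ∧ IsSpectralRate k h lam := by
  set R : ℝ := ratioBound k h + (∑ i, |h i|) / k + (M + 1) with hRdef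
  have hrb : 0 ≤ ratioBound k h := by unfold ratioBound; positivity
  have hR : 0 < R := by positivity
  -- `Q` bounds the weighted energy of an eigenvector relative to `|v_M|²`: `M + 1` entries, weights
  -- at most `1 + 1/k²`.
  set Q : ℝ := (M + 1) * ((1 + 1 / k ^ 2) * (R ^ M) ^ 2) with hQ
  have hQ0 : 0 < Q := by positivity
  have hlast : h (Fin.last M) < 0 := lt_of_le_of_ne (h_nonpos _) h_last
  -- The energy identity gives `Re μ ≤ h_M / Q`; halving makes the inequality strict.
  refine ⟨-h (Fin.last M) / (2 * Q), div_pos (neg_pos.2 hlast) (by positivity),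
    fun m hm μ hμ => ?_⟩
  obtain ⟨v, hv⟩ := hμ.exists_hasEigenvector
  have hv0 : v ≠ 0 := hv.2
  have hve : matGm k h m *ᵥ v = μ • v := hv.apply_eq_smul
  have hbd := norm_eigenvector_le hk h hm hv0 hve
  rw [← hRdef] at hbd
  have hL : 0 < ‖v (Fin.last M)‖ ^ 2 := by
    refine pow_pos (norm_pos_iff.2 fun h0 => hv0 ?_) 2
    ext i
    have := hbd i
    rw [h0, norm_zero, mul_zero] at this
    exact norm_le_zero_iff.1 this
  have hmk : k ^ 2 ≤ ((m : ℝ) * k) ^ 2 := by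
    rw [mul_pow]
    refine le_mul_of_one_le_left (sq_nonneg k) ?_
    exact_mod_cast (sq_pos_of_ne_zero hm : 0 < m ^ 2)
  have hw1 : ∀ i : Fin (M + 1), 1 ≤ weight k m i := by
    intro i
    unfold weight
    split_ifs
    · have : 0 ≤ 1 / ((m : ℝ) * k) ^ 2 := by positivity
      linarith
    · exact le_rfl
  have hw2 : ∀ i : Fin (M + 1), weight k m i ≤ 1 + 1 / k ^ 2 := by
    intro i
    unfold weight
    split_ifs
    · gcongr
    · have : 0 ≤ 1 / k ^ 2 := by positivity
      linarith
  have hN : ∑ i, weight k m i * ‖v i‖ ^ 2 ≤ Q * ‖v (Fin.last M)‖ ^ 2 := by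
    calc ∑ i, weight k m i * ‖v i‖ ^ 2
        ≤ ∑ i : Fin (M + 1), (1 + 1 / k ^ 2) * (R ^ M * ‖v (Fin.last M)‖) ^ 2 := by
          gcongr with i
          · exact hw2 i
          · exact hbd i
      _ = _ := by
          rw [Finset.sum_const, Finset.card_univ, Fintype.card_fin, nsmul_eq_mul, hQ]
          push_cast
          ring
  have hneg : ∑ i, weight k m i * h i * ‖v i‖ ^ 2 ≤ h (Fin.last M) * ‖v (Fin.last M)‖ ^ 2 := by
    have h1 : ∀ i, weight k m i * h i * ‖v i‖ ^ 2 ≤ 0 := fun i =>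
      mul_nonpos_of_nonpos_of_nonneg (mul_nonpos_of_nonneg_of_nonpos
        (zero_le_one.trans (hw1 i)) (h_nonpos i)) (sq_nonneg _)
    have h2 := Finset.single_le_sum (f := fun i => -(weight k m i * h i * ‖v i‖ ^ 2))
      (fun i _ => neg_nonneg.2 (h1 i)) (Finset.mem_univ (Fin.last M))
    rw [Finset.sum_neg_distrib, neg_le_neg_iff] at h2
    refine h2.trans (mul_le_mul_of_nonneg_right ?_ hL.le)
    have := mul_le_mul_of_nonpos_right (hw1 (Fin.last M)) hlast.le
    rwa [one_mul] at this
  have hid := re_mul_sum_weight k h m hve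
  by_contra! hcon
  have h1 : -μ.re * (∑ i, weight k m i * ‖v i‖ ^ 2) ≤
      -h (Fin.last M) / (2 * Q) * (Q * ‖v (Fin.last M)‖ ^ 2) := by
    have h2 : 0 ≤ ∑ i, weight k m i * ‖v i‖ ^ 2 :=
      Finset.sum_nonneg fun i _ => mul_nonneg (zero_le_one.trans (hw1 i)) (sq_nonneg _)
    have h3 : 0 ≤ -h (Fin.last M) / (2 * Q) := div_nonneg (neg_pos.2 hlast).le (by positivity)
    exact (mul_le_mul_of_nonneg_right (neg_le.1 hcon) h2).trans (mul_le_mul_of_nonneg_left hN h3)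
  have h2 : -h (Fin.last M) / (2 * Q) * (Q * ‖v (Fin.last M)‖ ^ 2) =
      -h (Fin.last M) / 2 * ‖v (Fin.last M)‖ ^ 2 := by
    field_simp
  have h3 : h (Fin.last M) * ‖v (Fin.last M)‖ ^ 2 < 0 := mul_neg_of_neg_of_pos hlast hL
  rw [h2] at h1
  linarith

end SpectralGap

/-! ### Decay of the expansion coefficients -/

section Expansion

variable {M : ℕ}

/-- `B` is a weighted shift whose weights are at most `√M`. -/
lemma norm_act_matB_le : ‖act (matB M)‖ ≤ Real.sqrt M := by
  refine ContinuousLinearMap.opNorm_le_bound _ (Real.sqrt_nonneg _) fun x => ?_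
  have h0 : (matB M *ᵥ WithLp.ofLp x) 0 = 0 := by
    rw [mulVec, dotProduct]
    exact Finset.sum_eq_zero fun j _ => by simp [matB]
  have h1 : ∀ i : Fin M, (matB M *ᵥ WithLp.ofLp x) i.succ =
      (Real.sqrt (i.succ : ℕ) : ℂ) * x i.castSucc := by
    intro i
    rw [mulVec, dotProduct, Finset.sum_eq_single i.castSucc]
    · simp [matB]
    · intro j _ hj
      have : ¬ ((i.succ : Fin (M + 1)) : ℕ) = (j : ℕ) + 1 := by
        intro h2
        rw [Fin.val_succ] at h2
        exact hj (Fin.ext (by rw [Fin.val_castSucc]; omega))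
      rw [matB, of_apply, if_neg this, zero_mul]
    · simp
  rw [← sq_le_sq₀ (norm_nonneg _) (by positivity), mul_pow, Real.sq_sqrt (Nat.cast_nonneg M),
    EuclideanSpace.norm_sq_eq, EuclideanSpace.norm_sq_eq, Fin.sum_univ_succ,
    Fin.sum_univ_castSucc (n := M), mul_add, Finset.mul_sum]
  change ‖(matB M *ᵥ WithLp.ofLp x) 0‖ ^ 2 +
    ∑ i : Fin M, ‖(matB M *ᵥ WithLp.ofLp x) i.succ‖ ^ 2 ≤ _
  rw [h0, norm_zero, zero_pow two_ne_zero, zero_add]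
  refine (Finset.sum_le_sum fun i _ => ?_).trans (le_add_of_nonneg_right (by positivity))
  rw [h1, norm_mul, mul_pow, Complex.norm_real, Real.norm_of_nonneg (Real.sqrt_nonneg _),
    Real.sq_sqrt (Nat.cast_nonneg _)]
  gcongr
  exact i.2

lemma integrableOn_sq_mul_exp (M : ℕ) {lam : ℝ} (hlam : 0 < lam) :
    IntegrableOn (fun s : ℝ => (s ^ M + 1) ^ 2 * Real.exp (-lam * s)) (Ioi 0) := by
  have h1 : ∀ n : ℕ, IntegrableOn (fun s : ℝ => s ^ n * Real.exp (-lam * s)) (Ioi 0) := by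
    intro n
    have := integrableOn_rpow_mul_exp_neg_mul_rpow (s := n) (p := 1) (b := lam)
      (by have : (0 : ℝ) ≤ n := Nat.cast_nonneg n
          linarith) one_pos hlam
    simpa using this
  refine ((h1 (2 * M)).add (((h1 M).const_mul 2).add (h1 0))).congr_fun (fun s _ => ?_)
    measurableSet_Ioi
  simp only [Pi.add_apply, pow_zero]
  ring

/-- The constants `K⁽ᵐ⁾`. -/
def expansionConst (C4 C5 : ℝ) : ℕ → ℝ
  -- A dummy value: in the recursion both indices `l` and `m - l` are at least 1.
  | 0 => 0
  | 1 => C4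
  | n + 2 => C5 * ∑ l ∈ (Finset.Icc 1 (n + 1)).attach,
      1 / (l.1 : ℝ) * expansionConst C4 C5 l.1 * expansionConst C4 C5 (n + 2 - l.1)
decreasing_by
  all_goals
    have := Finset.mem_Icc.1 l.2
    omega

lemma expansionConst_one (C4 C5 : ℝ) : expansionConst C4 C5 1 = C4 := by
  rw [expansionConst]

lemma expansionConst_of_two_le (C4 C5 : ℝ) {m : ℕ} (hm : 2 ≤ m) :
    expansionConst C4 C5 m = C5 * ∑ l ∈ Finset.Icc 1 (m - 1),
      1 / (l : ℝ) * expansionConst C4 C5 l * expansionConst C4 C5 (m - l) := by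
  obtain ⟨n, rfl⟩ := Nat.exists_eq_add_of_le' hm
  rw [expansionConst, Finset.sum_attach (Finset.Icc 1 (n + 1)) fun l =>
    1 / (l : ℝ) * expansionConst C4 C5 l * expansionConst C4 C5 (n + 2 - l)]
  rfl

lemma act_matGm_apply (k : ℝ) (h : Fin (M + 1) → ℝ) (m : ℤ)
    (x : EuclideanSpace ℂ (Fin (M + 1))) :
    act (matGm k h m) x =
      act (matH h) x - (Complex.I * (m : ℂ) * (k : ℂ)) • act (matAG M k m) x := by
  rw [matGm, act, map_add, map_smul]
  change -(Complex.I * (m : ℂ) * (k : ℂ)) • act (matAG M k m) x + act (matH h) x = _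
  rw [neg_smul, neg_add_eq_sub]

/-- Each product of two coefficients decays twice; the two exponentials stay separate because
Duhamel uses them for different purposes. -/
lemma norm_convolution_le {k lam : ℝ} (hk : 0 < k) {p : ℝ → ℝ}
    {f : ℕ → ℝ → EuclideanSpace ℂ (Fin (M + 1))} {K : ℕ → ℝ} {m : ℕ} {s : ℝ}
    (hf : ∀ l, 1 ≤ l → l < m → ‖f l s‖ ≤ K l * p s * Real.exp (-lam * s)) :
    ‖(Complex.I / (k : ℂ)) • ∑ l ∈ Finset.Icc 1 (m - 1),
      ((1 / (l : ℂ)) * f l s 0) • act (matB M) (f (m - l) s)‖ ≤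
      Real.sqrt M / k * (∑ l ∈ Finset.Icc 1 (m - 1), 1 / (l : ℝ) * K l * K (m - l)) *
        (p s ^ 2 * Real.exp (-lam * s) * Real.exp (-lam * s)) := by
  rw [norm_smul, norm_div, Complex.norm_I, Complex.norm_real, Real.norm_of_nonneg hk.le]
  have h1 : ‖∑ l ∈ Finset.Icc 1 (m - 1), ((1 / (l : ℂ)) * f l s 0) • act (matB M) (f (m - l) s)‖ ≤
      ∑ l ∈ Finset.Icc 1 (m - 1), Real.sqrt M * (1 / (l : ℝ) * K l * K (m - l)) *
        (p s ^ 2 * Real.exp (-lam * s) * Real.exp (-lam * s)) := by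
    refine norm_sum_le_of_le _ fun l hl => ?_
    have hl' := Finset.mem_Icc.1 hl
    have h2 := hf l hl'.1 (by omega)
    have h3 := hf (m - l) (by omega) (by omega)
    have h4 : ‖f l s 0‖ ≤ ‖f l s‖ := PiLp.norm_apply_le (f l s) 0
    rw [norm_smul, norm_mul, norm_div, norm_one, Complex.norm_natCast]
    calc 1 / (l : ℝ) * ‖f l s 0‖ * ‖act (matB M) (f (m - l) s)‖
        ≤ 1 / (l : ℝ) * (K l * p s * Real.exp (-lam * s)) *
          (Real.sqrt M * (K (m - l) * p s * Real.exp (-lam * s))) := by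
          have h5 := h4.trans h2
          have h6 : 0 ≤ K l * p s * Real.exp (-lam * s) := (norm_nonneg _).trans h2
          gcongr
          exact ContinuousLinearMap.le_of_opNorm_le_of_le _ norm_act_matB_le h3
      _ = _ := by ring
  rw [← Finset.sum_mul, ← Finset.mul_sum] at h1
  calc _ ≤ 1 / k * (Real.sqrt M * (∑ l ∈ Finset.Icc 1 (m - 1), 1 / (l : ℝ) * K l * K (m - l)) *
        (p s ^ 2 * Real.exp (-lam * s) * Real.exp (-lam * s))) := by
        gcongr
    _ = _ := by ring

/-- Decay of the expansion coefficients. -/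
lemma IsExpansionSolution.norm_le {k lam C : ℝ} (hk : 0 < k) (hlam : 0 < lam) (hC : 0 < C)
    {h : Fin (M + 1) → ℝ}
    (hexp : ∀ m : ℤ, m ≠ 0 → ∀ t : ℝ, 0 ≤ t →
      ‖NormedSpace.exp ((t : ℂ) • act (matGm k h m))‖ ≤ C * (t ^ M + 1) * Real.exp (-lam * t))
    {f : ℕ → ℝ → EuclideanSpace ℂ (Fin (M + 1))} (hf : IsExpansionSolution k h f) (m : ℕ)
    (hm : 1 ≤ m) : ∀ t : ℝ, 0 ≤ t →
      ‖f m t‖ ≤ expansionConst C (constC5 M k lam C) m * (t ^ M + 1) * Real.exp (-lam * t) := by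
  set K := expansionConst C (constC5 M k lam C) with hK
  induction m using Nat.strong_induction_on with
  | _ m ih =>
  intro t ht
  rcases hm.eq_or_lt with rfl | hm2
  · have h1 := norm_le_of_duhamel (act (matGm k h 1)) (f := f 1) (g := fun _ => 0) ht
      (fun s hs => by
        rw [act_matGm_apply, add_zero, Int.cast_one, mul_one]
        exact hf.first_eq s hs) (β := fun _ => 0) continuous_const (by simp)
    rw [intervalIntegral.integral_zero, add_zero, hf.first_init] at h1
    refine h1.trans ((ContinuousLinearMap.le_of_opNorm_le _ (hexp 1 one_ne_zero t ht) _).trans ?_)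
    rw [hK, expansionConst_one, PiLp.norm_single, norm_one, mul_one]
  · have hm0 : (m : ℤ) ≠ 0 := by omega
    set Sg := ∑ l ∈ Finset.Icc 1 (m - 1), 1 / (l : ℝ) * K l * K (m - l) with hSg
    set g : ℝ → EuclideanSpace ℂ (Fin (M + 1)) := fun s =>
      -((Complex.I / (k : ℂ)) • ∑ l ∈ Finset.Icc 1 (m - 1),
        ((1 / (l : ℂ)) * f l s 0) • act (matB M) (f (m - l) s)) with hg
    have hK0 : ∀ l, 1 ≤ l → l < m → 0 ≤ K l := by
      intro l hl hlm
      -- Nonnegativity of `K l` is read off from the inductive bound at time 1.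
      have h1 := (norm_nonneg _).trans (ih l hlm hl 1 zero_le_one)
      rw [mul_assoc] at h1
      exact nonneg_of_mul_nonneg_left h1 (by positivity)
    have hSg0 : 0 ≤ Sg := Finset.sum_nonneg fun l hl => by
      have hl' := Finset.mem_Icc.1 hl
      have h1 := hK0 l hl'.1 (by omega)
      have h2 := hK0 (m - l) (by omega) (by omega)
      positivity
    set A : ℝ := C * (t ^ M + 1) * Real.exp (-lam * t) * (Real.sqrt M / k * Sg) with hA
    have hA0 : 0 ≤ A := by positivity
    have h1 := norm_le_of_duhamel (act (matGm k h m)) (f := f m) (g := g) ht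
      (fun s hs => by
        rw [act_matGm_apply, hg, ← sub_eq_add_neg]
        exact_mod_cast hf.higher_eq m hm2 s hs)
      (β := fun s => A * ((s ^ M + 1) ^ 2 * Real.exp (-lam * s))) (by fun_prop) (by
        intro s hs hst
        have h2 : ‖g s‖ ≤ Real.sqrt M / k * Sg *
            ((s ^ M + 1) ^ 2 * Real.exp (-lam * s) * Real.exp (-lam * s)) := by
          rw [hg, norm_neg]
          exact norm_convolution_le hk (p := fun s => s ^ M + 1)
            (fun l hl hlm => ih l hlm hl s hs)
        -- Replacing `(t - s)^M` by `t^M` frees the polynomial factor from `s`, so it leaves the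
        -- integral.
        have h3 : ‖NormedSpace.exp (((t - s : ℝ) : ℂ) • act (matGm k h m))‖ ≤
            C * (t ^ M + 1) * Real.exp (-lam * (t - s)) := by
          refine (hexp m hm0 (t - s) (by linarith)).trans ?_
          have : 0 ≤ t - s := by linarith
          gcongr
          linarith
        refine (ContinuousLinearMap.le_of_opNorm_le_of_le _ h3 h2).trans_eq ?_
        have h4 : Real.exp (-lam * t) = Real.exp (-lam * (t - s)) * Real.exp (-lam * s) := by
          rw [← Real.exp_add]
          ring_nf
        rw [hA, h4]
        ring)
    rw [hf.higher_init m hm2, map_zero, norm_zero, zero_add,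
      intervalIntegral.integral_const_mul] at h1
    have h2 : ∫ s in (0 : ℝ)..t, (s ^ M + 1) ^ 2 * Real.exp (-lam * s) ≤
        ∫ s in Ioi (0 : ℝ), (s ^ M + 1) ^ 2 * Real.exp (-lam * s) := by
      rw [intervalIntegral.integral_of_le ht]
      exact setIntegral_mono_set (integrableOn_sq_mul_exp M hlam)
        (Filter.Eventually.of_forall fun s => by positivity) Ioc_subset_Ioi_self.eventuallyLE
    refine h1.trans ((mul_le_mul_of_nonneg_left h2 hA0).trans_eq ?_)
    rw [hK, expansionConst_of_two_le _ _ hm2, ← hK, ← hSg, hA, constC5]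
    ring

end Expansion

end FilteredLandau

end
theorem mainTheorem6 (M : ℕ) (k : ℝ) (hk : 0 < k) (h : Fin (M + 1) → ℝ)
    (h_nonpos : ∀ i, h i ≤ 0) (h_first : h 0 = 0) (h_last : h (Fin.last M) ≠ 0) :
    (∃ lam : ℝ, 0 < lam ∧ FilteredLandau.IsSpectralRate k h lam) ∧
    ∀ lam : ℝ, 0 < lam → FilteredLandau.IsSpectralRate k h lam →
      ∃ C4 : ℝ, 0 < C4 ∧
        (∀ m : ℤ, m ≠ 0 → ∀ t : ℝ, 0 ≤ t →
          ‖FilteredLandau.act (NormedSpace.exp ((t : ℂ) • FilteredLandau.matGm k h m))‖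
            ≤ C4 * (t ^ M + 1) * Real.exp (-lam * t)) ∧
        ∃ K : ℕ → ℝ,
          K 1 = C4 ∧
          (∀ m : ℕ, 2 ≤ m →
            K m = FilteredLandau.constC5 M k lam C4 *
              ∑ l ∈ Finset.Icc 1 (m - 1), (1 / (l : ℝ)) * K l * K (m - l)) ∧
          ∀ f : ℕ → ℝ → EuclideanSpace ℂ (Fin (M + 1)),
            FilteredLandau.IsExpansionSolution k h f →
            ∀ m : ℕ, 1 ≤ m → ∀ t : ℝ, 0 ≤ t →
              ‖f m t‖ ≤ K m * (t ^ M + 1) * Real.exp (-lam * t) := by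

  refine ⟨FilteredLandau.exists_isSpectralRate hk h h_nonpos h_last, fun lam hlam hrate => ?_⟩
  obtain ⟨C, hC, hexp⟩ := FilteredLandau.exists_norm_exp_matGm_le hk h
  refine ⟨C, hC, fun m hm t ht => ?_,
    FilteredLandau.expansionConst C (FilteredLandau.constC5 M k lam C),
    FilteredLandau.expansionConst_one _ _,
    fun m hm => FilteredLandau.expansionConst_of_two_le _ _ hm,
    fun f hf m hm => hf.norm_le hk hlam hC (hexp lam hrate) m hm⟩
  have h1 := hexp lam hrate m hm t ht
  rwa [FilteredLandau.act_exp, FilteredLandau.act, map_smul]
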